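/- Let $n,m\ge 0$ be integers, let $\Lambda:\mathbb{R}^n\to GL(n,\mathbb{R})$ be an arbitrary map and let $\mu$ be a Radon measure on $\mathbb{R}^n$. Write $B(x,r)$ for the closed Euclidean ball and $B_\Lambda(a,r)=a+\Lambda(a)B(0,r)$. Suppose that for $\mu$-almost every $a\in\mathbb{R}^n$ the $m$-dimensional $\Lambda$-density $$\theta^m_\Lambda(\mu,a)=\lim_{r\downarrow 0}\frac{\mu(B_\Lambda(a,r))}{r^m}$$ exists and satisfies $0<\theta^m_\Lambda(\mu,a)<\infty$. For $a\in\mathbb{R}^n$ let $\mathrm{Tan}_\Lambda(\mu,a)$ be the set of all non-zero Radon measures $\nu$ on $\mathbb{R}^n$ for which there are $c_i>0$ and $r_i\downarrow 0$ such that the measures $c_i\,T^\Lambda_{a,r_i}[\mu]$ converge to $\nu$ in the weak-$*$ sense (tested against continuous functions of compact support), where $T^\Lambda_{a,r}[\mu]$ is the image of $\mu$ under $y\mapsto \Lambda(a)^{-1}\big(\tfrac{y-a}{r}\big)$. Then for $\mu$-almost every $a$, every $\nu\in\mathrm{Tan}_\Lambda(\mu,a)$ is $m$-uniform (that is, $0\in\operatorname{spt}\nu$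 and there is $c>0$ with $\nu(B(x,r))=c\,r^m$ for all $x\in\operatorname{spt}\nu$ and all $r>0$), and more precisely $$\nu(B(x,r))=\nu(B(0,1))\,r^m\qquad\text{for all }x\in\operatorname{spt}\nu\text{ and all }r>0.$$ -/

import Mathlib

open MeasureTheory Filter Topology Set
open scoped ENNReal NNReal MatrixGroups

namespace LambdaTangent

/-- The linear map `y ↦ M y` of `ℝⁿ` given by an invertible matrix `M`. -/
noncomputable def act {n : ℕ} (M : GL (Fin n) ℝ) :
    EuclideanSpace ℝ (Fin n) →L[ℝ] EuclideanSpace ℝ (Fin n) :=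
  Matrix.toEuclideanCLM (n := Fin n) (𝕜 := ℝ) (M : Matrix (Fin n) (Fin n) ℝ)

/-- The ellipse `B_Λ(a, r) = a + Λ(a) B(0, r)`, with `B(0, r)` the closed Euclidean ball. -/
def ellipse {n : ℕ} (Λ : EuclideanSpace ℝ (Fin n) → GL (Fin n) ℝ)
    (a : EuclideanSpace ℝ (Fin n)) (r : ℝ) : Set (EuclideanSpace ℝ (Fin n)) :=
  (fun y => a + act (Λ a) y) '' Metric.closedBall 0 r

/-- The upper `Λ`-density `limsup_{r ↓ 0} μ(B_Λ(a, r)) / r ^ m`. -/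
noncomputable def upperDensity {n : ℕ} (m : ℕ) (Λ : EuclideanSpace ℝ (Fin n) → GL (Fin n) ℝ)
    (μ : Measure (EuclideanSpace ℝ (Fin n))) (a : EuclideanSpace ℝ (Fin n)) : ℝ≥0∞ :=
  limsup (fun r : ℝ => μ (ellipse Λ a r) / ENNReal.ofReal (r ^ m)) (𝓝[>] 0)

/-- The lower `Λ`-density `liminf_{r ↓ 0} μ(B_Λ(a, r)) / r ^ m`. -/
noncomputable def lowerDensity {n : ℕ} (m : ℕ) (Λ : EuclideanSpace ℝ (Fin n) → GL (Fin n) ℝ)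
    (μ : Measure (EuclideanSpace ℝ (Fin n))) (a : EuclideanSpace ℝ (Fin n)) : ℝ≥0∞ :=
  liminf (fun r : ℝ => μ (ellipse Λ a r) / ENNReal.ofReal (r ^ m)) (𝓝[>] 0)

/-- The `m`-dimensional `Λ`-density of `μ` at `a` exists, as a positive and finite number:
the lower and upper densities agree, and their common value lies in `(0, ∞)`. -/
def HasDensity {n : ℕ} (m : ℕ) (Λ : EuclideanSpace ℝ (Fin n) → GL (Fin n) ℝ)
    (μ : Measure (EuclideanSpace ℝ (Fin n))) (a : EuclideanSpace ℝ (Fin n)) : Prop :=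
  lowerDensity m Λ μ a = upperDensity m Λ μ a ∧
    0 < lowerDensity m Λ μ a ∧ upperDensity m Λ μ a < ∞

/-- The rescaling `T^Λ_{a, r}(y) = Λ(a)⁻¹ ((y - a) / r)`. -/
noncomputable def rescale {n : ℕ} (Λ : EuclideanSpace ℝ (Fin n) → GL (Fin n) ℝ)
    (a : EuclideanSpace ℝ (Fin n)) (r : ℝ) (y : EuclideanSpace ℝ (Fin n)) :
    EuclideanSpace ℝ (Fin n) :=
  act (Λ a)⁻¹ (r⁻¹ • (y - a))

/-- Weak-* convergence of (Radon) measures on `ℝⁿ`: convergence of the integrals of all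
continuous compactly supported functions. -/
def WeakStarTendsto {n : ℕ} (μs : ℕ → Measure (EuclideanSpace ℝ (Fin n)))
    (ν : Measure (EuclideanSpace ℝ (Fin n))) : Prop :=
  ∀ f : EuclideanSpace ℝ (Fin n) → ℝ, Continuous f → HasCompactSupport f →
    Tendsto (fun i => ∫ y, f y ∂(μs i)) atTop (𝓝 (∫ y, f y ∂ν))

/-- The set `Tan_Λ(μ, a)` of `Λ`-tangents of `μ` at `a`: the non-zero Radon (that is, locally
finite Borel) measures on `ℝⁿ` of the form `lim c_i T^Λ_{a, r_i}[μ]` with `c_i > 0`, `r_i ↓ 0`. -/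
def Tan {n : ℕ} (Λ : EuclideanSpace ℝ (Fin n) → GL (Fin n) ℝ)
    (μ : Measure (EuclideanSpace ℝ (Fin n))) (a : EuclideanSpace ℝ (Fin n)) :
    Set (Measure (EuclideanSpace ℝ (Fin n))) :=
  {ν | IsLocallyFiniteMeasure ν ∧ ν ≠ 0 ∧
    ∃ (c : ℕ → ℝ≥0) (r : ℕ → ℝ), (∀ i, 0 < c i) ∧ (∀ i, 0 < r i) ∧ Tendsto r atTop (𝓝 0) ∧
      WeakStarTendsto (fun i => c i • μ.map (rescale Λ a (r i))) ν}

/-- `ν` is an `m`-uniform measure on `ℝⁿ`. -/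
def IsUniform {n : ℕ} (m : ℕ) (ν : Measure (EuclideanSpace ℝ (Fin n))) : Prop :=
  IsLocallyFiniteMeasure ν ∧ 0 ∈ ν.support ∧
    ∃ c : ℝ, 0 < c ∧ ∀ x ∈ ν.support, ∀ r : ℝ, 0 < r →
      ν (Metric.closedBall x r) = ENNReal.ofReal (c * r ^ m)

end LambdaTangent

namespace LambdaTangent

/-! The set of points with a density is covered by countably many pieces on which `Λ` and the
density are constant up to a factor `K` near `1`, with density bounds uniform below a common scale
(`ae_exists_isComparable`). The pieces need not be measurable, but the Besicovitch density theorem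
holds for arbitrary sets, so almost every `a` is a density point of a piece `S` containing it. Let
`ν` be a tangent at such an `a`. Along a subsequence `c i * r i ^ m` tends to some `b` in `(0, ∞)`.
Each support point `x` of `ν` is approached by rescaled points `z` of `S`, since otherwise a ball
around `x` would have vanishing mass in the limit (`frequently_exists_mem_rescale`). As `Λ z` is
close to `Λ a`, the preimage of a ball near `x` is nearly an ellipse of `Λ` at `z`, whose mass is
known up to `K`. Letting `K` tend to `1` gives `ν (B(x, s)) = b * θ * s ^ m`. -/

/-- Euclidean `n`-space. -/
abbrev 𝔼 (n : ℕ) : Type := EuclideanSpace ℝ (Fin n)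

variable {n m : ℕ}

/-! ### Weak-* limits and masses of closed balls. -/

section WeakStar

variable {μs : ℕ → Measure (𝔼 n)} {ν : Measure (𝔼 n)}

/-- A continuous cutoff function, equal to `1` on `closedBall x s` and vanishing outside of
`closedBall x t`. -/
noncomputable def cutoff (x : 𝔼 n) (s t : ℝ) (y : 𝔼 n) : ℝ :=
  max 0 (min 1 ((t - dist y x) / (t - s)))

lemma continuous_cutoff (x : 𝔼 n) (s t : ℝ) : Continuous (cutoff x s t) := by
  unfold cutoff
  fun_prop

lemma cutoff_nonneg (x : 𝔼 n) (s t : ℝ) (y : 𝔼 n) : 0 ≤ cutoff x s t y := le_max_left _ _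

lemma cutoff_le_one (x : 𝔼 n) (s t : ℝ) (y : 𝔼 n) : cutoff x s t y ≤ 1 :=
  max_le zero_le_one (min_le_left _ _)

lemma cutoff_eq_one {x : 𝔼 n} {s t : ℝ} (hst : s < t) {y : 𝔼 n} (hy : y ∈ Metric.closedBall x s) :
    cutoff x s t y = 1 := by
  have h : 1 ≤ (t - dist y x) / (t - s) := by
    rw [one_le_div (by linarith)]
    linarith [Metric.mem_closedBall.1 hy]
  simp [cutoff, min_eq_left h]

lemma cutoff_eq_zero {x : 𝔼 n} {s t : ℝ} (hst : s < t) {y : 𝔼 n} (hy : y ∉ Metric.closedBall x t) :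
    cutoff x s t y = 0 := by
  have h : (t - dist y x) / (t - s) ≤ 0 :=
    div_nonpos_of_nonpos_of_nonneg
      (by linarith [not_le.1 (fun h => hy (Metric.mem_closedBall.2 h))]) (by linarith)
  exact max_eq_left ((min_le_right _ _).trans h)

lemma hasCompactSupport_cutoff (x : 𝔼 n) {s t : ℝ} (hst : s < t) :
    HasCompactSupport (cutoff x s t) :=
  HasCompactSupport.intro (isCompact_closedBall x t) fun _ hy => cutoff_eq_zero hst hy

lemma measure_closedBall_le_lintegral_cutoff (ν : Measure (𝔼 n)) (x : 𝔼 n) {s t : ℝ} (hst : s < t) :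
    ν (Metric.closedBall x s) ≤ ∫⁻ y, ENNReal.ofReal (cutoff x s t y) ∂ν := by
  rw [← lintegral_indicator_one Metric.isClosed_closedBall.measurableSet]
  refine lintegral_mono fun y => ?_
  by_cases hy : y ∈ Metric.closedBall x s
  · simp [indicator_of_mem hy, cutoff_eq_one hst hy]
  · simp [indicator_of_notMem hy]

lemma lintegral_cutoff_le_measure_closedBall (ν : Measure (𝔼 n)) (x : 𝔼 n) {s t : ℝ} (hst : s < t) :
    ∫⁻ y, ENNReal.ofReal (cutoff x s t y) ∂ν ≤ ν (Metric.closedBall x t) := by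
  rw [← lintegral_indicator_one Metric.isClosed_closedBall.measurableSet]
  refine lintegral_mono fun y => ?_
  by_cases hy : y ∈ Metric.closedBall x t
  · simpa [indicator_of_mem hy] using cutoff_le_one x s t y
  · simp [indicator_of_notMem hy, cutoff_eq_zero hst hy]

lemma WeakStarTendsto.tendsto_lintegral_cutoff (h : WeakStarTendsto μs ν)
    [∀ i, IsLocallyFiniteMeasure (μs i)] [IsLocallyFiniteMeasure ν] (x : 𝔼 n) {s t : ℝ}
    (hst : s < t) :
    Tendsto (fun i => ∫⁻ y, ENNReal.ofReal (cutoff x s t y) ∂(μs i)) atTop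
      (𝓝 (∫⁻ y, ENNReal.ofReal (cutoff x s t y) ∂ν)) := by
  have hc := continuous_cutoff x s t
  have hk := hasCompactSupport_cutoff x hst
  have key : ∀ κ : Measure (𝔼 n), IsLocallyFiniteMeasure κ →
      ∫⁻ y, ENNReal.ofReal (cutoff x s t y) ∂κ = ENNReal.ofReal (∫ y, cutoff x s t y ∂κ) :=
    fun κ _ => (ofReal_integral_eq_lintegral_ofReal (hc.integrable_of_hasCompactSupport hk)
      (Eventually.of_forall (cutoff_nonneg x s t))).symm
  rw [key ν inferInstance]
  simp_rw [fun i => key (μs i) inferInstance]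
  exact ENNReal.tendsto_ofReal (h _ hc hk)

/-- The gap `s < t` makes room for a continuous cutoff, so the boundary of the ball need not be
null. Since the cutoff integrals converge, bounds at infinitely many indices suffice. -/
lemma WeakStarTendsto.measure_closedBall_le (h : WeakStarTendsto μs ν)
    [∀ i, IsLocallyFiniteMeasure (μs i)] [IsLocallyFiniteMeasure ν] {x : 𝔼 n} {s t : ℝ}
    (hst : s < t) {u : ℕ → ℝ≥0∞} {D : ℝ≥0∞} (hu : Tendsto u atTop (𝓝 D))
    (hfreq : ∃ᶠ i in atTop, μs i (Metric.closedBall x t) ≤ u i) :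
    ν (Metric.closedBall x s) ≤ D :=
  (measure_closedBall_le_lintegral_cutoff ν x hst).trans <|
    le_of_tendsto_of_tendsto_of_frequently (h.tendsto_lintegral_cutoff x hst) hu <|
      hfreq.mono fun _ hi => (lintegral_cutoff_le_measure_closedBall _ x hst).trans hi

lemma WeakStarTendsto.le_measure_closedBall (h : WeakStarTendsto μs ν)
    [∀ i, IsLocallyFiniteMeasure (μs i)] [IsLocallyFiniteMeasure ν] {x : 𝔼 n} {s t : ℝ}
    (hst : s < t) {u : ℕ → ℝ≥0∞} {D : ℝ≥0∞} (hu : Tendsto u atTop (𝓝 D))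
    (hfreq : ∃ᶠ i in atTop, u i ≤ μs i (Metric.closedBall x s)) :
    D ≤ ν (Metric.closedBall x t) :=
  (le_of_tendsto_of_tendsto_of_frequently hu (h.tendsto_lintegral_cutoff x hst) <|
      hfreq.mono fun _ hi => hi.trans (measure_closedBall_le_lintegral_cutoff _ x hst)).trans <|
    lintegral_cutoff_le_measure_closedBall ν x hst

end WeakStar

/-! ### Ellipses as preimages of balls under the rescalings. -/

section Ellipse

variable {Λ : 𝔼 n → GL (Fin n) ℝ} {μ : Measure (𝔼 n)}

lemma act_mul (M N : GL (Fin n) ℝ) : act (M * N) = act M * act N := by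
  simp [act]

lemma act_one : act (1 : GL (Fin n) ℝ) = 1 := by
  simp [act]

lemma act_inv_mul (M : GL (Fin n) ℝ) : act M⁻¹ * act M = 1 := by
  rw [← act_mul, inv_mul_cancel, act_one]

lemma act_mul_inv (M : GL (Fin n) ℝ) : act M * act M⁻¹ = 1 := by
  rw [← act_mul, mul_inv_cancel, act_one]

lemma act_inv_apply (M : GL (Fin n) ℝ) (y : 𝔼 n) : act M⁻¹ (act M y) = y :=
  DFunLike.congr_fun (act_inv_mul M) y

lemma act_apply_inv (M : GL (Fin n) ℝ) (y : 𝔼 n) : act M (act M⁻¹ y) = y :=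
  DFunLike.congr_fun (act_mul_inv M) y

lemma mem_ellipse {a y : 𝔼 n} {t : ℝ} : y ∈ ellipse Λ a t ↔ ‖act (Λ a)⁻¹ (y - a)‖ ≤ t := by
  constructor
  · rintro ⟨z, hz, rfl⟩
    simpa [act_inv_apply] using hz
  · intro h
    exact ⟨act (Λ a)⁻¹ (y - a), by simpa using h, by simp [act_apply_inv]⟩

lemma continuous_rescale (a : 𝔼 n) (r : ℝ) : Continuous (rescale Λ a r) := by
  unfold rescale
  fun_prop

lemma rescale_sub_rescale (a a' y : 𝔼 n) (r : ℝ) :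
    rescale Λ a r y - rescale Λ a r a' = r⁻¹ • act (Λ a)⁻¹ (y - a') := by
  rw [rescale, rescale, ← map_sub, ← smul_sub, map_smul]
  congr 2
  abel

lemma rescale_self (a : 𝔼 n) (r : ℝ) : rescale Λ a r a = 0 := by
  simp [rescale]

lemma mem_closedBall_rescale {a a' y : 𝔼 n} {r t : ℝ} (hr : 0 < r) :
    rescale Λ a r y ∈ Metric.closedBall (rescale Λ a r a') t ↔
      ‖act (Λ a)⁻¹ (y - a')‖ ≤ t * r := by
  rw [mem_closedBall_iff_norm, rescale_sub_rescale, norm_smul, norm_inv, Real.norm_of_nonneg hr.le,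
    inv_mul_le_iff₀ hr, mul_comm]

lemma rescale_preimage_closedBall_zero (a : 𝔼 n) {r : ℝ} (hr : 0 < r) (t : ℝ) :
    rescale Λ a r ⁻¹' Metric.closedBall 0 t = ellipse Λ a (t * r) := by
  ext y
  rw [mem_preimage, ← rescale_self (Λ := Λ) a r, mem_closedBall_rescale hr, mem_ellipse]

/-- Writing `Λ(a)⁻¹ = (Λ(a)⁻¹ Λ(a')) Λ(a')⁻¹` shows that changing the shape matrix costs a factor
`K` in the radius. -/
lemma ellipse_subset_rescale_preimage {a a' : 𝔼 n} {r K t : ℝ} (hr : 0 < r) (hK : 0 < K)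
    (h : ‖act (Λ a)⁻¹ * act (Λ a')‖ ≤ K) :
    ellipse Λ a' (t / K * r) ⊆ rescale Λ a r ⁻¹' Metric.closedBall (rescale Λ a r a') t := by
  intro y hy
  rw [mem_preimage, mem_closedBall_rescale hr]
  rw [mem_ellipse] at hy
  calc ‖act (Λ a)⁻¹ (y - a')‖
      = ‖(act (Λ a)⁻¹ * act (Λ a')) (act (Λ a')⁻¹ (y - a'))‖ := by
        rw [ContinuousLinearMap.mul_def, ContinuousLinearMap.comp_apply, act_apply_inv]
    _ ≤ K * (t / K * r) := (ContinuousLinearMap.le_opNorm _ _).trans (by gcongr)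
    _ = t * r := by field_simp

lemma rescale_preimage_subset_ellipse {a a' : 𝔼 n} {r K t : ℝ} (hr : 0 < r) (hK : 0 < K)
    (h : ‖act (Λ a')⁻¹ * act (Λ a)‖ ≤ K) :
    rescale Λ a r ⁻¹' Metric.closedBall (rescale Λ a r a') t ⊆ ellipse Λ a' (K * t * r) := by
  intro y hy
  rw [mem_preimage, mem_closedBall_rescale hr] at hy
  rw [mem_ellipse]
  calc ‖act (Λ a')⁻¹ (y - a')‖
      = ‖(act (Λ a')⁻¹ * act (Λ a)) (act (Λ a)⁻¹ (y - a'))‖ := by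
        rw [ContinuousLinearMap.mul_def, ContinuousLinearMap.comp_apply, act_apply_inv]
    _ ≤ K * (t * r) := (ContinuousLinearMap.le_opNorm _ _).trans (by gcongr)
    _ = K * t * r := by ring

lemma ellipse_subset_closedBall (a : 𝔼 n) {t : ℝ} :
    ellipse Λ a t ⊆ Metric.closedBall a (‖act (Λ a)‖ * t) := by
  intro y hy
  rw [mem_ellipse] at hy
  rw [mem_closedBall_iff_norm, ← act_apply_inv (Λ a) (y - a)]
  exact (ContinuousLinearMap.le_opNorm _ _).trans (by gcongr)

lemma closedBall_subset_ellipse (a : 𝔼 n) {t : ℝ} :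
    Metric.closedBall a t ⊆ ellipse Λ a (‖act (Λ a)⁻¹‖ * t) := by
  intro y hy
  rw [mem_closedBall_iff_norm] at hy
  rw [mem_ellipse]
  exact (ContinuousLinearMap.le_opNorm _ _).trans (by gcongr)

lemma blowup_closedBall (c : ℝ≥0) (a x : 𝔼 n) (r t : ℝ) :
    (c • μ.map (rescale Λ a r)) (Metric.closedBall x t) =
      c * μ (rescale Λ a r ⁻¹' Metric.closedBall x t) := by
  rw [Measure.smul_apply, Measure.map_apply (continuous_rescale a r).measurable
    Metric.isClosed_closedBall.measurableSet, ENNReal.smul_def, smul_eq_mul]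

lemma isLocallyFiniteMeasure_blowup [IsLocallyFiniteMeasure μ] (c : ℝ≥0) (a : 𝔼 n) {r : ℝ}
    (hr : 0 < r) : IsLocallyFiniteMeasure (c • μ.map (rescale Λ a r)) := by
  refine ⟨fun x => ⟨Metric.closedBall x 1, Metric.closedBall_mem_nhds x one_pos, ?_⟩⟩
  rw [blowup_closedBall]
  refine ENNReal.mul_lt_top ENNReal.coe_lt_top ?_
  have hsub : Metric.closedBall x 1 ⊆ Metric.closedBall (0 : 𝔼 n) (1 + dist x 0) :=
    Metric.closedBall_subset_closedBall' le_rfl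
  refine (measure_mono ((preimage_mono hsub).trans ?_)).trans_lt
    (measure_closedBall_lt_top (x := a) (r := ‖act (Λ a)‖ * ((1 + dist x 0) * r)))
  rw [rescale_preimage_closedBall_zero a hr]
  exact ellipse_subset_closedBall a

lemma HasDensity.exists_tendsto {a : 𝔼 n} (h : HasDensity m Λ μ a) :
    ∃ θ : ℝ, 0 < θ ∧ Tendsto (fun r : ℝ => μ (ellipse Λ a r) / ENNReal.ofReal (r ^ m)) (𝓝[>] 0)
      (𝓝 (ENNReal.ofReal θ)) := by
  obtain ⟨h1, h2, h3⟩ := h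
  have h4 : lowerDensity m Λ μ a ≠ ∞ := by rw [h1]; exact h3.ne
  refine ⟨(lowerDensity m Λ μ a).toReal, ENNReal.toReal_pos h2.ne' h4, ?_⟩
  rw [ENNReal.ofReal_toReal h4]
  exact tendsto_of_liminf_eq_limsup rfl h1.symm

end Ellipse

/-! ### Countable decomposition into pieces of nearly constant shape and density. -/

section Pieces

variable {Λ : 𝔼 n → GL (Fin n) ℝ} {μ : Measure (𝔼 n)}

/-- The points of `S` have, up to the factor `K`, the shape matrix `Λ a` and the density `θ`,
the latter uniformly at all scales below `ρ`. -/
def IsComparable (m : ℕ) (Λ : 𝔼 n → GL (Fin n) ℝ) (μ : Measure (𝔼 n)) (K θ ρ : ℝ) (a : 𝔼 n)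
    (S : Set (𝔼 n)) : Prop :=
  ∀ b ∈ S, ‖act (Λ a)⁻¹ * act (Λ b)‖ ≤ K ∧ ‖act (Λ b)⁻¹ * act (Λ a)‖ ≤ K ∧
    ∀ r, 0 < r → r < ρ → μ (ellipse Λ b r) ≤ ENNReal.ofReal (K * θ * r ^ m) ∧
      ENNReal.ofReal (θ / K * r ^ m) ≤ μ (ellipse Λ b r)

/-- Thresholds of the form `1 / (j + 1)` keep the family of pieces countable. -/
lemma exists_uniform_radius {b : 𝔼 n} {K θ : ℝ} (hK : 1 < K) (hθ : 0 < θ)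
    (h : Tendsto (fun r : ℝ => μ (ellipse Λ b r) / ENNReal.ofReal (r ^ m)) (𝓝[>] 0)
      (𝓝 (ENNReal.ofReal θ))) :
    ∃ j : ℕ, ∀ r : ℝ, 0 < r → r < 1 / ((j : ℝ) + 1) →
      μ (ellipse Λ b r) ≤ ENNReal.ofReal (K * θ * r ^ m) ∧
        ENNReal.ofReal (θ / K * r ^ m) ≤ μ (ellipse Λ b r) := by
  have hlt : ENNReal.ofReal θ < ENNReal.ofReal (K * θ) :=
    (ENNReal.ofReal_lt_ofReal_iff (by positivity)).2 (by nlinarith)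
  have hgt : ENNReal.ofReal (θ / K) < ENNReal.ofReal θ :=
    (ENNReal.ofReal_lt_ofReal_iff hθ).2 (div_lt_self hθ hK)
  obtain ⟨δ, hδ, hsub⟩ := mem_nhdsGT_iff_exists_Ioo_subset.1
    ((h.eventually_le_const hlt).and (h.eventually_const_le hgt))
  obtain ⟨j, hj⟩ := exists_nat_one_div_lt (mem_Ioi.1 hδ)
  refine ⟨j, fun r hr hrj => ?_⟩
  obtain ⟨h1, h2⟩ := hsub ⟨hr, hrj.trans hj⟩
  have hpos : ENNReal.ofReal (r ^ m) ≠ 0 := by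
    simpa using pow_pos hr m
  constructor
  · rw [ENNReal.ofReal_mul (by positivity)]
    exact (ENNReal.div_le_iff hpos ENNReal.ofReal_ne_top).1 h1
  · rw [ENNReal.ofReal_mul (by positivity)]
    exact (ENNReal.le_div_iff_mul_le (Or.inl hpos) (Or.inl ENNReal.ofReal_ne_top)).1 h2

/-- Equality fails for `n = 0`. -/
lemma norm_one_le : ‖(1 : 𝔼 n →L[ℝ] 𝔼 n)‖ ≤ 1 := ContinuousLinearMap.norm_id_le

/-- The Lindelöf property is applied to `F '' A` inside `X` and the cover is pulled back, so `F` may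
be arbitrary. -/
theorem exists_countable_cover_of_eventually_nhds_diag {α X : Type*} [TopologicalSpace X]
    [SecondCountableTopology X] {A : Set α} {F : α → X} {Rel : X → X → Prop}
    (h : ∀ a ∈ A, ∀ᶠ z in 𝓝 (F a, F a), Rel z.1 z.2) :
    ∃ 𝒱 : Set (Set α), 𝒱.Countable ∧ A ⊆ ⋃₀ 𝒱 ∧
      ∀ V ∈ 𝒱, ∀ a ∈ V, ∀ b ∈ V, Rel (F a) (F b) := by
  have hV : ∀ p ∈ F '' A, ∃ V ∈ 𝓝 p, ∀ q ∈ V, ∀ q' ∈ V, Rel q q' := by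
    rintro _ ⟨a, ha, rfl⟩
    have := h a ha
    rw [nhds_prod_eq] at this
    obtain ⟨V, hV, hsub⟩ := mem_prod_same_iff.1 this
    exact ⟨V, hV, fun q hq q' hq' => hsub (mk_mem_prod hq hq')⟩
  choose! V hVnhds hVrel using hV
  obtain ⟨t, htA, htc, hcov⟩ := TopologicalSpace.countable_cover_nhdsWithin
    (s := F '' A) (f := V) fun p hp => mem_nhdsWithin_of_mem_nhds (hVnhds p hp)
  refine ⟨(fun p => F ⁻¹' V p) '' t, htc.image _, fun a ha => ?_, ?_⟩
  · obtain ⟨p, hp, hap⟩ := mem_iUnion₂.1 (hcov ⟨a, ha, rfl⟩)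
    exact ⟨_, ⟨p, hp, rfl⟩, hap⟩
  · rintro _ ⟨p, hp, rfl⟩ a ha b hb
    exact hVrel p (htA hp) _ ha _ hb

/-- The data at a point: a matrix, its inverse, and a density. -/
abbrev Shape (n : ℕ) : Type := (𝔼 n →L[ℝ] 𝔼 n) × (𝔼 n →L[ℝ] 𝔼 n) × ℝ

lemma eventually_close_shape {p : Shape n} {K L : ℝ} (hK : 1 < K) (hL : 1 < L)
    (h : p.2.1 * p.1 = 1) (hp : 0 < p.2.2) :
    ∀ᶠ z : Shape n × Shape n in 𝓝 (p, p),
      ‖z.1.2.1 * z.2.1‖ < K ∧ z.1.2.2 < L * z.2.2.2 := by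
  have h1 : Continuous fun z : Shape n × Shape n => ‖z.1.2.1 * z.2.1‖ := by fun_prop
  have h2 : Continuous fun z : Shape n × Shape n => z.1.2.2 := by fun_prop
  have h3 : Continuous fun z : Shape n × Shape n => L * z.2.2.2 := by fun_prop
  refine (h1.continuousAt.eventually_lt continuousAt_const ?_).and
    (h2.continuousAt.eventually_lt h3.continuousAt ?_)
  · simpa only [h] using norm_one_le.trans_lt hK
  · show p.2.2 < L * p.2.2
    nlinarith

theorem ae_exists_isComparable [IsLocallyFiniteMeasure μ] {θ : 𝔼 n → ℝ}
    (hθ : ∀ a, HasDensity m Λ μ a → 0 < θ a ∧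
      Tendsto (fun r : ℝ => μ (ellipse Λ a r) / ENNReal.ofReal (r ^ m)) (𝓝[>] 0)
        (𝓝 (ENNReal.ofReal (θ a))))
    (hμ : ∀ᵐ a ∂μ, HasDensity m Λ μ a) {K : ℝ} (hK : 1 < K) :
    ∀ᵐ a ∂μ, ∃ (S : Set (𝔼 n)) (ρ : ℝ), 0 < ρ ∧ IsComparable m Λ μ K (θ a) ρ a S ∧
      Tendsto (fun r => μ (S ∩ Metric.closedBall a r) / μ (Metric.closedBall a r)) (𝓝[>] 0)
        (𝓝 1) := by
  -- One factor `L` pays for the density ratio at small scales, the other for the variation of `θ`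
  -- over a piece.
  obtain ⟨L, hL, hLK⟩ : ∃ L : ℝ, 1 < L ∧ L * L = K :=
    ⟨√K, Real.lt_sqrt_of_sq_lt (by simpa using hK), Real.mul_self_sqrt (by linarith)⟩
  have hL0 : 0 < L := by linarith
  set F : 𝔼 n → Shape n := fun a => (act (Λ a), act (Λ a)⁻¹, θ a) with hF
  set A : Set (𝔼 n) := {a | HasDensity m Λ μ a} with hA
  obtain ⟨𝒱, h𝒱c, hcov, hrel⟩ := exists_countable_cover_of_eventually_nhds_diag (A := A) (F := F)
    (Rel := fun q q' => ‖q.2.1 * q'.1‖ < K ∧ q.2.2 < L * q'.2.2)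
    fun a ha => eventually_close_shape hK hL (by simp [hF, act_inv_mul]) (hθ a ha).1
  set R : ℕ → Set (𝔼 n) := fun j => {b | b ∈ A ∧ ∀ r : ℝ, 0 < r → r < 1 / ((j : ℝ) + 1) →
      μ (ellipse Λ b r) ≤ ENNReal.ofReal (L * θ b * r ^ m) ∧
        ENNReal.ofReal (θ b / L * r ^ m) ≤ μ (ellipse Λ b r)} with hR
  -- No measurability of `R j ∩ V` is needed here.
  have hdens : ∀ᵐ a ∂μ, ∀ V ∈ 𝒱, ∀ j : ℕ, a ∈ R j ∩ V →
      Tendsto (fun r => μ (R j ∩ V ∩ Metric.closedBall a r) /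
        μ (Metric.closedBall a r)) (𝓝[>] 0) (𝓝 1) :=
    (ae_ball_iff h𝒱c).2 fun V _ => ae_all_iff.2 fun j =>
      ae_imp_of_ae_restrict (Besicovitch.ae_tendsto_measure_inter_div μ _)
  filter_upwards [hμ, hdens] with a ha hda
  obtain ⟨V, hV, haV⟩ := hcov ha
  obtain ⟨j, hj⟩ := exists_uniform_radius hL (hθ a ha).1 (hθ a ha).2
  refine ⟨R j ∩ V, 1 / ((j : ℝ) + 1), by positivity, ?_, hda V hV j ⟨⟨ha, hj⟩, haV⟩⟩
  rintro b ⟨⟨hbA, hb⟩, hbV⟩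
  have hab := hrel V hV a haV b hbV
  have hba := hrel V hV b hbV a haV
  refine ⟨hab.1.le, hba.1.le, fun r hr hrj => ⟨?_, ?_⟩⟩
  · refine (hb r hr hrj).1.trans (ENNReal.ofReal_le_ofReal ?_)
    rw [← hLK, mul_assoc L L]
    gcongr
    exact hba.2.le
  · refine le_trans (ENNReal.ofReal_le_ofReal ?_) (hb r hr hrj).2
    rw [← hLK, ← div_div]
    gcongr
    rw [div_le_iff₀ hL0, mul_comm]
    exact hab.2.le

end Pieces

/-! ### Tangent measures at a density point of comparable pieces. -/

section Tangents

variable {Λ : 𝔼 n → GL (Fin n) ℝ} {μ ν : Measure (𝔼 n)} {c : ℕ → ℝ≥0} {r : ℕ → ℝ} {a : 𝔼 n}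
  {θ b : ℝ}

lemma tendsto_mul_ofReal_pow {B : ℝ≥0∞}
    (hb : Tendsto (fun i => (c i : ℝ≥0∞) * ENNReal.ofReal (r i ^ m)) atTop (𝓝 B))
    {k t : ℝ} (hk : 0 < k) (ht : 0 < t) :
    Tendsto (fun i => (c i : ℝ≥0∞) * ENNReal.ofReal (k * (t * r i) ^ m)) atTop
      (𝓝 (ENNReal.ofReal (k * t ^ m) * B)) := by
  have h := ENNReal.Tendsto.const_mul (a := ENNReal.ofReal (k * t ^ m)) hb
    (Or.inr ENNReal.ofReal_ne_top)
  refine h.congr fun i => ?_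
  rw [mul_pow, ← mul_assoc k, ENNReal.ofReal_mul (p := k * t ^ m) (by positivity)]
  ring

/-- `B` ranges over all of `[0, ∞]`, so that this limit can be used to rule out `0` and `∞`. -/
lemma tendsto_blowup_closedBall_zero {B : ℝ≥0∞} (hθ : 0 < θ)
    (hdens : Tendsto (fun r : ℝ => μ (ellipse Λ a r) / ENNReal.ofReal (r ^ m)) (𝓝[>] 0)
      (𝓝 (ENNReal.ofReal θ)))
    (hr : ∀ i, 0 < r i) (hr0 : Tendsto r atTop (𝓝 0))
    (hb : Tendsto (fun i => (c i : ℝ≥0∞) * ENNReal.ofReal (r i ^ m)) atTop (𝓝 B))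
    {t : ℝ} (ht : 0 < t) :
    Tendsto (fun i => (c i • μ.map (rescale Λ a (r i))) (Metric.closedBall 0 t)) atTop
      (𝓝 (ENNReal.ofReal (t ^ m) * B * ENNReal.ofReal θ)) := by
  have hθ' : ENNReal.ofReal θ ≠ 0 := by simpa using hθ
  have hscale : Tendsto (fun i => t * r i) atTop (𝓝[>] 0) :=
    tendsto_nhdsWithin_iff.2 ⟨by simpa using hr0.const_mul t,
      Eventually.of_forall fun i => mul_pos ht (hr i)⟩
  have h := ENNReal.Tendsto.mul (tendsto_mul_ofReal_pow hb one_pos ht) (Or.inr ENNReal.ofReal_ne_top)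
    (hdens.comp hscale) (Or.inl hθ')
  rw [one_mul] at h
  refine h.congr fun i => ?_
  have hpos : ENNReal.ofReal ((t * r i) ^ m) ≠ 0 := by
    simpa using pow_pos (mul_pos ht (hr i)) m
  rw [blowup_closedBall, rescale_preimage_closedBall_zero a (hr i), one_mul, Function.comp_apply,
    mul_assoc, ENNReal.mul_div_cancel hpos ENNReal.ofReal_ne_top]

lemma exists_closedBall_zero_ne_zero (hν : ν ≠ 0) :
    ∃ t : ℝ, 0 < t ∧ ν (Metric.closedBall 0 t) ≠ 0 := by
  by_contra! h
  refine hν (Measure.measure_univ_eq_zero.1 ?_)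
  rw [← Metric.iUnion_closedBall_nat (0 : 𝔼 n), measure_iUnion_null_iff]
  intro k
  exact measure_mono_null (Metric.closedBall_subset_closedBall (by linarith : (k : ℝ) ≤ k + 1))
    (h (k + 1) (by positivity))

/-- The normalising constants of a tangent measure are, along a subsequence, asymptotic to a
positive multiple of `r ^ (-m)`. -/
theorem exists_subseq_tendsto_mul_pow [IsLocallyFiniteMeasure μ] [IsLocallyFiniteMeasure ν]
    (hθ : 0 < θ)
    (hdens : Tendsto (fun r : ℝ => μ (ellipse Λ a r) / ENNReal.ofReal (r ^ m)) (𝓝[>] 0)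
      (𝓝 (ENNReal.ofReal θ)))
    (hr : ∀ i, 0 < r i) (hr0 : Tendsto r atTop (𝓝 0)) (hν : ν ≠ 0)
    (h : WeakStarTendsto (fun i => c i • μ.map (rescale Λ a (r i))) ν) :
    ∃ (φ : ℕ → ℕ) (b : ℝ), StrictMono φ ∧ 0 < b ∧
      Tendsto (fun i => (c (φ i) : ℝ≥0∞) * ENNReal.ofReal (r (φ i) ^ m)) atTop
        (𝓝 (ENNReal.ofReal b)) := by
  obtain ⟨B, φ, hφ, hB⟩ := CompactSpace.tendsto_subseq
    fun i => (c i : ℝ≥0∞) * ENNReal.ofReal (r i ^ m)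
  have hw : WeakStarTendsto (fun i => c (φ i) • μ.map (rescale Λ a (r (φ i)))) ν :=
    fun f hf hfc => (h f hf hfc).comp hφ.tendsto_atTop
  have : ∀ i, IsLocallyFiniteMeasure (c (φ i) • μ.map (rescale Λ a (r (φ i)))) :=
    fun i => isLocallyFiniteMeasure_blowup _ _ (hr _)
  have hmass := fun t => tendsto_blowup_closedBall_zero (t := t) hθ hdens (fun i => hr (φ i))
    (hr0.comp hφ.tendsto_atTop) hB
  have hθ' : ENNReal.ofReal θ ≠ 0 := by simpa using hθ
  -- `B = 0` would make `ν` vanish on every ball around `0`; `B = ∞` would give `closedBall 0 2`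
  -- infinite mass.
  have hB0 : B ≠ 0 := by
    rintro rfl
    obtain ⟨t, ht, hνt⟩ := exists_closedBall_zero_ne_zero hν
    have := hw.measure_closedBall_le (x := 0) (lt_add_one t) (hmass (t + 1) (by linarith))
      (Frequently.of_forall fun _ => le_rfl)
    simp [hνt] at this
  have hBtop : B ≠ ∞ := by
    rintro rfl
    have := hw.le_measure_closedBall (x := 0) one_lt_two (hmass 1 one_pos)
      (Frequently.of_forall fun _ => le_rfl)
    rw [one_pow, ENNReal.ofReal_one, one_mul, ENNReal.top_mul hθ'] at this
    exact measure_closedBall_lt_top.not_ge this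
  exact ⟨φ, B.toReal, hφ, ENNReal.toReal_pos hB0 hBtop, by rwa [ENNReal.ofReal_toReal hBtop]⟩

lemma rescale_preimage_subset_closedBall (a x : 𝔼 n) {ρ t : ℝ} (hρ : 0 < ρ) :
    rescale Λ a ρ ⁻¹' Metric.closedBall x t ⊆
      Metric.closedBall a ((‖act (Λ a)‖ * (t + dist x 0)) * ρ) := by
  have hsub : Metric.closedBall x t ⊆ Metric.closedBall (0 : 𝔼 n) (t + dist x 0) :=
    Metric.closedBall_subset_closedBall' le_rfl
  refine (preimage_mono hsub).trans ?_
  rw [rescale_preimage_closedBall_zero a hρ, mul_assoc]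
  exact ellipse_subset_closedBall a

/-- Additivity needs only one of the two disjoint sets to be measurable; here it is `Q`, as `S` may
fail to be. -/
lemma measure_le_mul_one_sub_of_disjoint {S Q V : Set (𝔼 n)} (hQ : MeasurableSet Q) (hQV : Q ⊆ V)
    (hd : Disjoint S Q) (hV : μ V ≠ ∞) : μ Q ≤ μ V * (1 - μ (S ∩ V) / μ V) := by
  rcases eq_or_ne (μ V) 0 with h0 | h0
  · simpa [h0] using (measure_mono hQV).trans_eq h0
  · have hsum : μ (S ∩ V) + μ Q ≤ μ V := by
      rw [← measure_union (hd.mono_left inter_subset_left) hQ]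
      exact measure_mono (union_subset inter_subset_right hQV)
    rw [ENNReal.mul_sub fun _ _ => hV, mul_one, ENNReal.mul_div_cancel h0 hV]
    exact ENNReal.le_sub_of_add_le_left (ne_top_of_le_ne_top hV (measure_mono inter_subset_right))
      hsum

/-- Every support point of a tangent measure is a limit of rescaled points of a set having `a` as
a density point. -/
theorem frequently_exists_mem_rescale [IsLocallyFiniteMeasure μ] [IsLocallyFiniteMeasure ν]
    (hθ : 0 < θ)
    (hdens : Tendsto (fun r : ℝ => μ (ellipse Λ a r) / ENNReal.ofReal (r ^ m)) (𝓝[>] 0)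
      (𝓝 (ENNReal.ofReal θ)))
    (hr : ∀ i, 0 < r i) (hr0 : Tendsto r atTop (𝓝 0))
    (h : WeakStarTendsto (fun i => c i • μ.map (rescale Λ a (r i))) ν)
    (hb : Tendsto (fun i => (c i : ℝ≥0∞) * ENNReal.ofReal (r i ^ m)) atTop
      (𝓝 (ENNReal.ofReal b))) {S : Set (𝔼 n)}
    (hS : Tendsto (fun r => μ (S ∩ Metric.closedBall a r) / μ (Metric.closedBall a r)) (𝓝[>] 0)
      (𝓝 1)) {x : 𝔼 n} (hx : x ∈ ν.support) {η : ℝ} (hη : 0 < η) :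
    ∃ᶠ i in atTop, ∃ z ∈ S, rescale Λ a (r i) z ∈ Metric.closedBall x η := by
  have : ∀ i, IsLocallyFiniteMeasure (c i • μ.map (rescale Λ a (r i))) :=
    fun i => isLocallyFiniteMeasure_blowup _ _ (hr _)
  intro hnot
  have hpos : 0 < ν (Metric.closedBall x (η / 2)) :=
    (Measure.mem_support_iff_forall x).1 hx _ (Metric.closedBall_mem_nhds x (by positivity))
  -- At scale `r i`, the preimage of `closedBall x η` lies in the Euclidean ball of radius `R * r i`
  -- at `a`, which lies in the ellipse of parameter `T * r i`. Adding `1` keeps both constants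
  -- positive.
  set R : ℝ := ‖act (Λ a)‖ * (η + dist x 0) + 1 with hR
  have hR0 : 0 < R := by positivity
  set T : ℝ := ‖act (Λ a)⁻¹‖ * R + 1 with hT
  have hT0 : 0 < T := by positivity
  have hscale : Tendsto (fun i => R * r i) atTop (𝓝[>] 0) :=
    tendsto_nhdsWithin_iff.2 ⟨by simpa using hr0.const_mul R,
      Eventually.of_forall fun i => mul_pos hR0 (hr i)⟩
  have hsub : Tendsto (fun i => 1 - μ (S ∩ Metric.closedBall a (R * r i)) /
      μ (Metric.closedBall a (R * r i))) atTop (𝓝 0) := by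
    simpa using ENNReal.Tendsto.sub tendsto_const_nhds (hS.comp hscale)
      (Or.inl ENNReal.one_ne_top)
  have hmass := tendsto_blowup_closedBall_zero hθ hdens hr hr0 hb hT0
  have hlim := ENNReal.Tendsto.mul hmass (Or.inr ENNReal.zero_ne_top) hsub
    (Or.inr (by finiteness))
  rw [mul_zero] at hlim
  -- If `S` misses the preimage, its mass is at most a bounded quantity times the proportion of the
  -- ball outside `S`, which tends to `0`.
  refine hpos.not_ge (h.measure_closedBall_le (half_lt_self hη) hlim
    (Eventually.frequently ?_))
  filter_upwards [hnot] with i hi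
  rw [blowup_closedBall, blowup_closedBall, mul_assoc]
  gcongr
  refine (measure_le_mul_one_sub_of_disjoint (S := S) (V := Metric.closedBall a (R * r i))
    ((continuous_rescale a (r i)).measurable Metric.isClosed_closedBall.measurableSet) ?_ ?_
    measure_closedBall_lt_top.ne).trans ?_
  · refine (rescale_preimage_subset_closedBall a x (hr i)).trans
      (Metric.closedBall_subset_closedBall ?_)
    have := (hr i).le
    gcongr
    linarith
  · exact disjoint_left.2 fun z hz hzx => hi ⟨z, hz, hzx⟩
  · gcongr
    rw [rescale_preimage_closedBall_zero a (hr i)]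
    refine (closedBall_subset_ellipse (Λ := Λ) a).trans fun y hy => ?_
    rw [mem_ellipse] at hy ⊢
    refine hy.trans ?_
    rw [← mul_assoc]
    have := (hr i).le
    gcongr
    linarith

/-- One `η` is the gap for the cutoff, the other moves the centre from `x` to a rescaled point of
`S`. The outer `K` comes from the density, the inner one from the shape. -/
theorem measure_closedBall_le_of_isComparable [IsLocallyFiniteMeasure μ]
    [IsLocallyFiniteMeasure ν] (hθ : 0 < θ)
    (hdens : Tendsto (fun r : ℝ => μ (ellipse Λ a r) / ENNReal.ofReal (r ^ m)) (𝓝[>] 0)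
      (𝓝 (ENNReal.ofReal θ)))
    (hr : ∀ i, 0 < r i) (hr0 : Tendsto r atTop (𝓝 0))
    (h : WeakStarTendsto (fun i => c i • μ.map (rescale Λ a (r i))) ν)
    (hb : Tendsto (fun i => (c i : ℝ≥0∞) * ENNReal.ofReal (r i ^ m)) atTop
      (𝓝 (ENNReal.ofReal b))) {S : Set (𝔼 n)} {K ρ : ℝ} (hK : 0 < K) (hρ : 0 < ρ)
    (hcomp : IsComparable m Λ μ K θ ρ a S)
    (hS : Tendsto (fun r => μ (S ∩ Metric.closedBall a r) / μ (Metric.closedBall a r)) (𝓝[>] 0)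
      (𝓝 1)) {x : 𝔼 n} (hx : x ∈ ν.support) {s η : ℝ} (hs : 0 < s) (hη : 0 < η) :
    ν (Metric.closedBall x s) ≤ ENNReal.ofReal (K * θ * (K * (s + 2 * η)) ^ m * b) := by
  have : ∀ i, IsLocallyFiniteMeasure (c i • μ.map (rescale Λ a (r i))) :=
    fun i => isLocallyFiniteMeasure_blowup _ _ (hr _)
  have ht : 0 < K * (s + 2 * η) := by positivity
  have hlim := tendsto_mul_ofReal_pow hb (mul_pos hK hθ) ht
  rw [← ENNReal.ofReal_mul (by positivity)] at hlim
  have hsmall : ∀ᶠ i in atTop, K * (s + 2 * η) * r i < ρ :=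
    (by simpa using hr0.const_mul (K * (s + 2 * η)) :
      Tendsto (fun i => K * (s + 2 * η) * r i) atTop (𝓝 0)).eventually_lt_const hρ
  refine h.measure_closedBall_le (lt_add_of_pos_right s hη) hlim
    (((frequently_exists_mem_rescale hθ hdens hr hr0 h hb hS hx hη).and_eventually
      hsmall).mono ?_)
  rintro i ⟨⟨z, hz, hzx⟩, hi⟩
  obtain ⟨-, hzK, hzd⟩ := hcomp z hz
  rw [blowup_closedBall]
  gcongr
  refine le_trans (measure_mono ?_) (hzd _ (mul_pos ht (hr i)) hi).1
  refine (preimage_mono (Metric.closedBall_subset_closedBall' ?_)).trans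
    (rescale_preimage_subset_ellipse (hr i) hK hzK)
  rw [dist_comm]
  linarith [Metric.mem_closedBall.1 hzx]

theorem le_measure_closedBall_of_isComparable [IsLocallyFiniteMeasure μ]
    [IsLocallyFiniteMeasure ν] (hθ : 0 < θ)
    (hdens : Tendsto (fun r : ℝ => μ (ellipse Λ a r) / ENNReal.ofReal (r ^ m)) (𝓝[>] 0)
      (𝓝 (ENNReal.ofReal θ)))
    (hr : ∀ i, 0 < r i) (hr0 : Tendsto r atTop (𝓝 0))
    (h : WeakStarTendsto (fun i => c i • μ.map (rescale Λ a (r i))) ν)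
    (hb : Tendsto (fun i => (c i : ℝ≥0∞) * ENNReal.ofReal (r i ^ m)) atTop
      (𝓝 (ENNReal.ofReal b))) {S : Set (𝔼 n)} {K ρ : ℝ} (hK : 0 < K) (hρ : 0 < ρ)
    (hcomp : IsComparable m Λ μ K θ ρ a S)
    (hS : Tendsto (fun r => μ (S ∩ Metric.closedBall a r) / μ (Metric.closedBall a r)) (𝓝[>] 0)
      (𝓝 1)) {x : 𝔼 n} (hx : x ∈ ν.support) {s η : ℝ} (hη : 0 < η) (hs : 0 < s - 2 * η) :
    ENNReal.ofReal (θ / K * ((s - 2 * η) / K) ^ m * b) ≤ ν (Metric.closedBall x s) := by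
  have : ∀ i, IsLocallyFiniteMeasure (c i • μ.map (rescale Λ a (r i))) :=
    fun i => isLocallyFiniteMeasure_blowup _ _ (hr _)
  have ht : 0 < (s - 2 * η) / K := by positivity
  have hlim := tendsto_mul_ofReal_pow hb (div_pos hθ hK) ht
  rw [← ENNReal.ofReal_mul (by positivity)] at hlim
  have hsmall : ∀ᶠ i in atTop, (s - 2 * η) / K * r i < ρ :=
    (by simpa using hr0.const_mul ((s - 2 * η) / K) :
      Tendsto (fun i => (s - 2 * η) / K * r i) atTop (𝓝 0)).eventually_lt_const hρ
  refine h.le_measure_closedBall (sub_lt_self s hη) hlim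
    (((frequently_exists_mem_rescale hθ hdens hr hr0 h hb hS hx hη).and_eventually
      hsmall).mono ?_)
  rintro i ⟨⟨z, hz, hzx⟩, hi⟩
  obtain ⟨hzK, -, hzd⟩ := hcomp z hz
  rw [blowup_closedBall]
  gcongr
  refine (hzd _ (mul_pos ht (hr i)) hi).2.trans (measure_mono ?_)
  refine (ellipse_subset_rescale_preimage (hr i) hK hzK).trans
    (preimage_mono (Metric.closedBall_subset_closedBall' ?_))
  linarith [Metric.mem_closedBall.1 hzx]

/-- A single `η = 1 / (q + 1)` serves both as `K - 1` and as the slack in the radius; both bounds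
are continuous at `η = 0`, with the same value there. -/
theorem measure_closedBall_of_mem_support [IsLocallyFiniteMeasure μ]
    [IsLocallyFiniteMeasure ν] (hθ : 0 < θ)
    (hdens : Tendsto (fun r : ℝ => μ (ellipse Λ a r) / ENNReal.ofReal (r ^ m)) (𝓝[>] 0)
      (𝓝 (ENNReal.ofReal θ)))
    (hr : ∀ i, 0 < r i) (hr0 : Tendsto r atTop (𝓝 0))
    (h : WeakStarTendsto (fun i => c i • μ.map (rescale Λ a (r i))) ν)
    (hb : Tendsto (fun i => (c i : ℝ≥0∞) * ENNReal.ofReal (r i ^ m)) atTop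
      (𝓝 (ENNReal.ofReal b)))
    (hpieces : ∀ q : ℕ, ∃ (S : Set (𝔼 n)) (ρ : ℝ), 0 < ρ ∧
      IsComparable m Λ μ (1 + 1 / ((q : ℝ) + 1)) θ ρ a S ∧
      Tendsto (fun r => μ (S ∩ Metric.closedBall a r) / μ (Metric.closedBall a r)) (𝓝[>] 0)
        (𝓝 1)) {x : 𝔼 n} (hx : x ∈ ν.support) {s : ℝ} (hs : 0 < s) :
    ν (Metric.closedBall x s) = ENNReal.ofReal (b * θ * s ^ m) := by
  have hη0 : Tendsto (fun q : ℕ => 1 / ((q : ℝ) + 1)) atTop (𝓝 0) :=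
    tendsto_one_div_add_atTop_nhds_zero_nat
  have hηpos : ∀ q : ℕ, 0 < 1 / ((q : ℝ) + 1) := fun q => by positivity
  apply le_antisymm
  · have hlim : Tendsto (fun η : ℝ => (1 + η) * θ * ((1 + η) * (s + 2 * η)) ^ m * b) (𝓝 0)
        (𝓝 (b * θ * s ^ m)) := by
      have hc : Continuous fun η : ℝ => (1 + η) * θ * ((1 + η) * (s + 2 * η)) ^ m * b := by
        fun_prop
      convert hc.tendsto 0 using 2
      simp
      ring
    refine ge_of_tendsto' (ENNReal.tendsto_ofReal (hlim.comp hη0)) fun q => ?_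
    obtain ⟨S, ρ, hρ, hcomp, hS⟩ := hpieces q
    exact measure_closedBall_le_of_isComparable hθ hdens hr hr0 h hb
      (by linarith [hηpos q]) hρ hcomp hS hx hs (hηpos q)
  · have hlim : Tendsto (fun η : ℝ => θ / (1 + η) * ((s - 2 * η) / (1 + η)) ^ m * b) (𝓝 0)
        (𝓝 (b * θ * s ^ m)) := by
      have hc : ContinuousAt (fun η : ℝ => θ / (1 + η) * ((s - 2 * η) / (1 + η)) ^ m * b) 0 := by
        fun_prop (disch := norm_num)
      convert hc.tendsto using 2
      simp
      ring
    refine le_of_tendsto (ENNReal.tendsto_ofReal (hlim.comp hη0)) ?_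
    -- The lower bound requires `2 * η < s`, hence only large `q`.
    filter_upwards [hη0.eventually_lt_const (half_pos hs)] with q hq
    obtain ⟨S, ρ, hρ, hcomp, hS⟩ := hpieces q
    exact le_measure_closedBall_of_isComparable hθ hdens hr hr0 h hb
      (by linarith [hηpos q]) hρ hcomp hS hx (hηpos q) (by linarith)

lemma zero_mem_support [IsLocallyFiniteMeasure μ]
    [IsLocallyFiniteMeasure ν] (hθ : 0 < θ)
    (hdens : Tendsto (fun r : ℝ => μ (ellipse Λ a r) / ENNReal.ofReal (r ^ m)) (𝓝[>] 0)
      (𝓝 (ENNReal.ofReal θ)))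
    (hr : ∀ i, 0 < r i) (hr0 : Tendsto r atTop (𝓝 0))
    (h : WeakStarTendsto (fun i => c i • μ.map (rescale Λ a (r i))) ν) (hb0 : 0 < b)
    (hb : Tendsto (fun i => (c i : ℝ≥0∞) * ENNReal.ofReal (r i ^ m)) atTop
      (𝓝 (ENNReal.ofReal b))) : 0 ∈ ν.support := by
  have : ∀ i, IsLocallyFiniteMeasure (c i • μ.map (rescale Λ a (r i))) :=
    fun i => isLocallyFiniteMeasure_blowup _ _ (hr _)
  refine Metric.nhds_basis_closedBall.mem_measureSupport.2 fun s hs => ?_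
  refine lt_of_lt_of_le ?_ (h.le_measure_closedBall (half_lt_self hs)
    (tendsto_blowup_closedBall_zero hθ hdens hr hr0 hb (half_pos hs))
    (Frequently.of_forall fun _ => le_rfl))
  have := pow_pos (half_pos hs) m
  simp [pos_iff_ne_zero, hb0, hθ, this]

theorem measure_closedBall_of_mem_tan [IsLocallyFiniteMeasure μ] (hθ : 0 < θ)
    (hdens : Tendsto (fun r : ℝ => μ (ellipse Λ a r) / ENNReal.ofReal (r ^ m)) (𝓝[>] 0)
      (𝓝 (ENNReal.ofReal θ)))
    (hpieces : ∀ q : ℕ, ∃ (S : Set (𝔼 n)) (ρ : ℝ), 0 < ρ ∧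
      IsComparable m Λ μ (1 + 1 / ((q : ℝ) + 1)) θ ρ a S ∧
      Tendsto (fun r => μ (S ∩ Metric.closedBall a r) / μ (Metric.closedBall a r)) (𝓝[>] 0)
        (𝓝 1)) (hν : ν ∈ Tan Λ μ a) :
    0 ∈ ν.support ∧ ∃ C : ℝ, 0 < C ∧ ∀ x ∈ ν.support, ∀ s : ℝ, 0 < s →
      ν (Metric.closedBall x s) = ENNReal.ofReal (C * s ^ m) := by
  obtain ⟨hfin, hne, c, r, -, hr, hr0, h⟩ := hν
  obtain ⟨φ, b, hφ, hb0, hb⟩ := exists_subseq_tendsto_mul_pow hθ hdens hr hr0 hne h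
  have hw : WeakStarTendsto (fun i => c (φ i) • μ.map (rescale Λ a (r (φ i)))) ν :=
    fun f hf hfc => (h f hf hfc).comp hφ.tendsto_atTop
  have hrφ := hr0.comp hφ.tendsto_atTop
  exact ⟨zero_mem_support hθ hdens (fun i => hr (φ i)) hrφ hw hb0 hb, b * θ, mul_pos hb0 hθ,
    fun x hx s hs => measure_closedBall_of_mem_support hθ hdens (fun i => hr (φ i)) hrφ hw hb
      hpieces hx hs⟩

end Tangents

end LambdaTangent

theorem theoremt (n m : ℕ)
    (Λ : EuclideanSpace ℝ (Fin n) → Matrix.GeneralLinearGroup (Fin n) ℝ)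
    (μ : MeasureTheory.Measure (EuclideanSpace ℝ (Fin n)))
    [MeasureTheory.IsLocallyFiniteMeasure μ]
    (hμ : ∀ᵐ a ∂μ, LambdaTangent.HasDensity m Λ μ a) :
    ∀ᵐ a ∂μ, ∀ ν ∈ LambdaTangent.Tan Λ μ a,
      LambdaTangent.IsUniform m ν ∧
        ∀ x ∈ ν.support, ∀ r : ℝ, 0 < r →
          ν (Metric.closedBall x r) = ν (Metric.closedBall 0 1) * ENNReal.ofReal (r ^ m) := by
  choose! θ hθ using fun (a : EuclideanSpace ℝ (Fin n))
    (ha : LambdaTangent.HasDensity m Λ μ a) => ha.exists_tendsto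
  -- Countably many values of `K` give one exceptional null set, chosen before `ν`.
  have hpieces := ae_all_iff.2 fun q : ℕ => LambdaTangent.ae_exists_isComparable hθ hμ
    (K := 1 + 1 / ((q : ℝ) + 1)) (lt_add_of_pos_right 1 (by positivity))
  filter_upwards [hμ, hpieces] with a ha hp ν hν
  obtain ⟨h0, C, hC, hball⟩ :=
    LambdaTangent.measure_closedBall_of_mem_tan (hθ a ha).1 (hθ a ha).2 hp hν
  refine ⟨⟨hν.1, h0, C, hC, hball⟩, fun x hx r hr => ?_⟩
  -- The constant is identified by evaluating at the support point `0` with radius `1`.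
  rw [hball x hx r hr, hball 0 h0 1 one_pos, one_pow, mul_one, ENNReal.ofReal_mul hC.le]
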